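/- Let $\ell\ge 0$ be an integer. An $\ell$-graph is a finite hypergraph (without repeated edges) each of whose edges is a set of exactly $\ell$ vertices. An $\ell$-graph is called $H$-free if it contains no (not necessarily induced) subgraph isomorphic to the $\ell$-graph $H$. For an $\ell$-graph $H$ with at least one edge, let $\mathrm{ex}(N,H)$ be the maximum number of edges of an $H$-free $\ell$-graph on the vertex set $[N]=\{1,\dots,N\}$. Then, for every $\ell$-graph $H$ with at least one edge, the limit $\pi(H)=\lim_{N\to\infty}\mathrm{ex}(N,H)\binom{N}{\ell}^{-1}$ exists, and the number of $H$-free $\ell$-graphs on the (labelled) vertex set $[N]$ is $$2^{(\pi(H)+o(1))\binom{N}{\ell}}\qquad (N\to\infty).$$ That is, there is a sequence $\delta(N)\to 0$ of real numbers such that for every integer $N\ge 0$ this number equals $2^{(\pi(H)+\delta(N))\binom{N}{\ell}}$. -/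

import Mathlib

/-- An `ℓ`-graph (`ℓ`-uniform hypergraph) with vertex set `V` and finitely many edges:
every edge is a set of exactly `ℓ` vertices. -/
@[ext]
structure LGraph (ℓ : ℕ) (V : Type*) where
  edges : Finset (Finset V)
  sized : (edges : Set (Finset V)).Sized ℓ

namespace LGraph

/-- `G` contains a subgraph isomorphic to `H`: some injection of the vertices of `H` into those
of `G` sends every edge of `H` to an edge of `G` (the images of the vertices and of the edges of
`H` then form the subgraph). The subgraph need not be induced. -/
def Contains {ℓ : ℕ} {V W : Type*} (G : LGraph ℓ W) (H : LGraph ℓ V) : Prop :=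
  ∃ f : V ↪ W, ∀ e ∈ H.edges, e.map f ∈ G.edges

/-- The set of `H`-free `ℓ`-graphs on the labelled vertex set `Fin N`. -/
def freeGraphs {ℓ : ℕ} {V : Type*} (H : LGraph ℓ V) (N : ℕ) : Set (LGraph ℓ (Fin N)) :=
  {G | ¬ G.Contains H}

/-- `ex(N, H)`: the largest number of edges of an `H`-free `ℓ`-graph on `N` vertices. -/
noncomputable def ex {ℓ : ℕ} {V : Type*} (N : ℕ) (H : LGraph ℓ V) : ℕ :=
  sSup ((fun G : LGraph ℓ (Fin N) => G.edges.card) '' H.freeGraphs N)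

/-- `π(H) = lim_{N → ∞} ex(N, H) / binom(N, ℓ)`. -/
noncomputable def turanDensity {ℓ : ℕ} {V : Type*} (H : LGraph ℓ V) : ℝ :=
  Filter.limUnder Filter.atTop (fun N : ℕ => (ex N H : ℝ) / (N.choose ℓ : ℝ))

end LGraph

namespace LGraph

open Finset

/-! The lower bound comes from the subgraphs of one extremal graph
(`two_pow_ex_le_ncard_freeGraphs`). Averaging over M-sets shows that ex(N,H)/binom(N,ℓ) eventually
decreases, so the limit exists; the same averaging gives supersaturation
(`exists_mul_pow_le_card_copies`).

For the upper bound with ℓ ≥ 1, every H-free family E is almost contained in one of 2^{o(N^ℓ)}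
containers. Approximate its indicator f on ℓ-tuples by a function g, starting from g = 1. If g has
many weighted copies of H while f has none, telescoping over the edges of H makes g - f correlate
with a test function in which the vertices outside one edge are fixed. Subtracting a multiple of
that function from g lowers the squared distance to f by a fixed proportion of N^ℓ. The test
function sees E only through the O(N^{ℓ-1}) sets meeting the fixed vertices
(`testFun_inter_meeting`), so a step has 2^{O(N^{ℓ-1})} outcomes, and boundedly many steps suffice.

At the end, the sets on which g > δ span few copies of H, so by supersaturation they number at most
(π(H)+o(1)) binom(N,ℓ), and E has few sets elsewhere. -/

/-! ### Extremal numbers and the lower bound -/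

theorem edges_injective {ℓ : ℕ} {W : Type*} :
    Function.Injective (LGraph.edges : LGraph ℓ W → Finset (Finset W)) :=
  fun _ _ h => LGraph.ext h

instance finite_of_finite {ℓ : ℕ} {W : Type*} [Finite W] : Finite (LGraph ℓ W) :=
  Finite.of_injective _ edges_injective

theorem edges_subset_powersetCard {ℓ : ℕ} {W : Type*} [Fintype W] (G : LGraph ℓ W) :
    G.edges ⊆ powersetCard ℓ univ :=
  fun _ he => mem_powersetCard_univ.2 (G.sized he)

theorem card_edges_le_choose {ℓ N : ℕ} (G : LGraph ℓ (Fin N)) :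
    G.edges.card ≤ N.choose ℓ := by
  simpa using card_le_card G.edges_subset_powersetCard

/-- The subgraph with a smaller set of edges. -/
def ofSubset {ℓ : ℕ} {W : Type*} (G : LGraph ℓ W) (E : Finset (Finset W)) (h : E ⊆ G.edges) :
    LGraph ℓ W :=
  ⟨E, fun _ he => G.sized (h he)⟩

theorem Contains.of_edges_subset {ℓ : ℕ} {V W : Type*} {H : LGraph ℓ V} {G G' : LGraph ℓ W}
    (h : G.Contains H) (hG : G.edges ⊆ G'.edges) : G'.Contains H := by
  obtain ⟨f, hf⟩ := h
  exact ⟨f, fun e he => hG (hf e he)⟩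

theorem not_contains_of_edges_eq_empty {ℓ : ℕ} {V W : Type*} {H : LGraph ℓ V}
    (hH : H.edges.Nonempty) {G : LGraph ℓ W} (hG : G.edges = ∅) : ¬ G.Contains H := by
  rintro ⟨f, hf⟩
  obtain ⟨e, he⟩ := hH
  simpa [hG] using hf e he

theorem freeGraphs_nonempty {ℓ : ℕ} {V : Type*} {H : LGraph ℓ V} (hH : H.edges.Nonempty) (N : ℕ) :
    (H.freeGraphs N).Nonempty :=
  ⟨⟨∅, by simp [Set.Sized]⟩, not_contains_of_edges_eq_empty hH rfl⟩

theorem bddAbove_card_edges {ℓ : ℕ} {V : Type*} (H : LGraph ℓ V) (N : ℕ) :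
    BddAbove ((fun G : LGraph ℓ (Fin N) => G.edges.card) '' H.freeGraphs N) := by
  refine ⟨N.choose ℓ, ?_⟩
  rintro _ ⟨G, -, rfl⟩
  exact G.card_edges_le_choose

theorem card_edges_le_ex {ℓ N : ℕ} {V : Type*} {H : LGraph ℓ V} {G : LGraph ℓ (Fin N)}
    (hG : ¬ G.Contains H) : G.edges.card ≤ ex N H :=
  le_csSup (H.bddAbove_card_edges N) ⟨G, hG, rfl⟩

theorem exists_card_edges_eq_ex {ℓ : ℕ} {V : Type*} {H : LGraph ℓ V} (hH : H.edges.Nonempty)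
    (N : ℕ) : ∃ G : LGraph ℓ (Fin N), ¬ G.Contains H ∧ G.edges.card = ex N H :=
  Nat.sSup_mem ((freeGraphs_nonempty hH N).image _) (H.bddAbove_card_edges N)

theorem two_pow_ex_le_ncard_freeGraphs {ℓ : ℕ} {V : Type*} {H : LGraph ℓ V}
    (hH : H.edges.Nonempty) (N : ℕ) : 2 ^ ex N H ≤ (H.freeGraphs N).ncard := by
  obtain ⟨G, hG, hcard⟩ := exists_card_edges_eq_ex hH N
  rw [← hcard, ← card_powerset, ← Set.ncard_coe_finset,
    ← Set.ncard_image_of_injective (H.freeGraphs N) edges_injective]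
  refine Set.ncard_le_ncard ?_ (Set.toFinite _)
  intro E hE
  have hE' : E ⊆ G.edges := by simpa using hE
  exact ⟨G.ofSubset E hE', fun h => hG (h.of_edges_subset hE'), rfl⟩

/-! ### Averaging, existence of the limit, supersaturation -/

/-- The edges of the pull-back of `G` along an embedding of the vertices. -/
def comap {ℓ : ℕ} {U W : Type*} [Fintype U] [DecidableEq W] (G : LGraph ℓ W) (θ : U ↪ W) :
    LGraph ℓ U :=
  ⟨{S : Finset U | S.map θ ∈ G.edges}, by
    intro S hS
    have := G.sized (Finset.mem_coe.2 (mem_filter.1 (Finset.mem_coe.1 hS)).2)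
    simpa using this⟩

theorem mem_edges_comap {ℓ : ℕ} {U W : Type*} [Fintype U] [DecidableEq W] {G : LGraph ℓ W}
    {θ : U ↪ W} {S : Finset U} : S ∈ (G.comap θ).edges ↔ S.map θ ∈ G.edges := by
  simp [comap]

theorem card_edges_comap {ℓ : ℕ} {U W : Type*} [Fintype U] [DecidableEq W] (G : LGraph ℓ W)
    (θ : U ↪ W) : (G.comap θ).edges.card = #{S ∈ G.edges | S ⊆ univ.map θ} := by
  refine card_bij (fun S _ => S.map θ) ?_ ?_ ?_
  · intro S hS
    exact mem_filter.2 ⟨mem_edges_comap.1 hS, map_subset_map.2 (subset_univ _)⟩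
  · intro S _ T _ h
    exact map_injective θ h
  · intro S hS
    obtain ⟨h1, h2⟩ := mem_filter.1 hS
    obtain ⟨T, -, rfl⟩ := subset_map_iff.1 h2
    exact ⟨T, mem_edges_comap.2 h1, rfl⟩

/-- The injective maps of vertices that send every edge of `H` into `E`. -/
def copies {ℓ : ℕ} {V W : Type*} [Fintype V] [DecidableEq V] [Fintype W] [DecidableEq W]
    (H : LGraph ℓ V) (E : Finset (Finset W)) : Finset (V → W) :=
  {φ | Function.Injective φ ∧ ∀ e ∈ H.edges, e.image φ ∈ E}

theorem contains_iff_copies_nonempty {ℓ : ℕ} {V W : Type*} [Fintype V] [DecidableEq V]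
    [Fintype W] [DecidableEq W] {H : LGraph ℓ V} {G : LGraph ℓ W} :
    G.Contains H ↔ (H.copies G.edges).Nonempty := by
  constructor
  · rintro ⟨f, hf⟩
    refine ⟨f, mem_filter.2 ⟨mem_univ _, f.injective, fun e he => ?_⟩⟩
    rw [← map_eq_image]
    exact hf e he
  · rintro ⟨φ, hφ⟩
    obtain ⟨-, h1, h2⟩ := mem_filter.1 hφ
    refine ⟨⟨φ, h1⟩, fun e he => ?_⟩
    rw [map_eq_image]
    exact h2 e he

theorem sum_card_filter_subset {ℓ N M : ℕ} (G : LGraph ℓ (Fin N)) (hM : ℓ ≤ M) :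
    ∑ A ∈ powersetCard M univ, #{S ∈ G.edges | S ⊆ A}
      = G.edges.card * (N - ℓ).choose (M - ℓ) := by
  rw [← smul_eq_mul]
  refine (sum_card_bipartiteAbove_eq_sum_card_bipartiteBelow
    fun A S : Finset (Fin N) => S ⊆ A).trans ?_
  refine sum_eq_card_nsmul fun S hS => ?_
  have h : S.card = ℓ := G.sized hS
  have := card_filter_powersetCard_subset S univ M (subset_univ S) (h.le.trans hM)
  rwa [h, card_univ, Fintype.card_fin] at this

/-- Counting edges inside the `M`-subsets of the vertex set, where an `M`-subset without a copy
of `H` has at most `ex M H` edges. -/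
theorem card_edges_mul_choose_le {ℓ N M : ℕ} {V : Type*} [Fintype V] [DecidableEq V]
    (H : LGraph ℓ V) (G : LGraph ℓ (Fin N)) (hℓ : ℓ ≤ M) (hv : Fintype.card V ≤ M) :
    G.edges.card * (N - ℓ).choose (M - ℓ) ≤ N.choose M * ex M H
      + (H.copies G.edges).card * (N - Fintype.card V).choose (M - Fintype.card V)
        * M.choose ℓ := by
  classical
  rw [← sum_card_filter_subset G hℓ]
  set B : Finset (Finset (Fin N)) :=
    (H.copies G.edges).biUnion fun φ => {A ∈ powersetCard M univ | univ.image φ ⊆ A} with hB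
  have hBcard : B.card ≤
      (H.copies G.edges).card * (N - Fintype.card V).choose (M - Fintype.card V) := by
    refine card_biUnion_le_card_mul _ _ _ fun φ hφ => ?_
    have hinj := (mem_filter.1 hφ).2.1
    have hc : (univ.image φ).card = Fintype.card V := by
      rw [card_image_of_injective _ hinj, card_univ]
    have := card_filter_powersetCard_subset (univ.image φ) univ M (subset_univ _) (hc.le.trans hv)
    rw [hc, card_univ, Fintype.card_fin] at this
    exact this.le
  have key : ∀ A ∈ powersetCard M (univ : Finset (Fin N)),
      #{S ∈ G.edges | S ⊆ A} ≤ ex M H + if A ∈ B then M.choose ℓ else 0 := by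
    intro A hA
    have hAM := mem_powersetCard_univ.1 hA
    set θ := (A.orderEmbOfFin hAM).toEmbedding with hθ
    have hAθ : univ.map θ = A := A.map_orderEmbOfFin_univ hAM
    rw [← hAθ, ← card_edges_comap]
    split_ifs with hAB
    · exact (card_edges_le_choose _).trans (Nat.le_add_left _ _)
    · rw [add_zero]
      refine card_edges_le_ex fun ⟨f, hf⟩ => hAB ?_
      refine mem_biUnion.2 ⟨f.trans θ, ?_, ?_⟩
      · refine mem_filter.2 ⟨mem_univ _, (f.trans θ).injective, fun e he => ?_⟩
        have := mem_edges_comap.1 (hf e he)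
        rwa [map_map, map_eq_image] at this
      · refine mem_filter.2 ⟨by rwa [hAθ], ?_⟩
        intro a ha
        obtain ⟨b, -, rfl⟩ := mem_image.1 ha
        simp
  refine (sum_le_sum key).trans ?_
  rw [sum_add_distrib, sum_const, card_powersetCard, card_univ, Fintype.card_fin, smul_eq_mul,
    sum_ite, sum_const_zero, add_zero, sum_const, smul_eq_mul]
  gcongr
  refine le_trans (card_le_card ?_) hBcard
  intro A hA
  exact (mem_filter.1 hA).2

/-- The double count is divided by binom(N,M)·binom(M,ℓ). The last term bounds the proportion of
M-sets that contain a copy. -/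
theorem card_edges_div_choose_le {ℓ N M : ℕ} {V : Type*} [Fintype V] [DecidableEq V]
    (H : LGraph ℓ V) (G : LGraph ℓ (Fin N)) (hℓ : ℓ ≤ M) (hv : Fintype.card V ≤ M) (hN : M ≤ N) :
    (G.edges.card : ℝ) / N.choose ℓ ≤ (ex M H : ℝ) / M.choose ℓ
      + (H.copies G.edges).card * (M.choose (Fintype.card V)) / N.choose (Fintype.card V) := by
  have h := card_edges_mul_choose_le H G hℓ hv
  set v := Fintype.card V
  have e1 : (N.choose M : ℝ) * M.choose ℓ = N.choose ℓ * (N - ℓ).choose (M - ℓ) := by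
    exact_mod_cast Nat.choose_mul (n := N) hℓ
  have e2 : (N.choose M : ℝ) * M.choose v = N.choose v * (N - v).choose (M - v) := by
    exact_mod_cast Nat.choose_mul (n := N) hv
  have h' : (G.edges.card : ℝ) * (N - ℓ).choose (M - ℓ) ≤ N.choose M * ex M H
      + (H.copies G.edges).card * (N - v).choose (M - v) * M.choose ℓ := by exact_mod_cast h
  have p1 : (0 : ℝ) < N.choose ℓ := by exact_mod_cast Nat.choose_pos (hℓ.trans hN)
  have p2 : (0 : ℝ) < N.choose v := by exact_mod_cast Nat.choose_pos (hv.trans hN)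
  have p3 : (0 : ℝ) < M.choose ℓ := by exact_mod_cast Nat.choose_pos hℓ
  have p4 : (0 : ℝ) < N.choose M := by exact_mod_cast Nat.choose_pos hN
  have e3 : (G.edges.card : ℝ) / N.choose ℓ
      = G.edges.card * (N - ℓ).choose (M - ℓ) / (N.choose M * M.choose ℓ) := by
    have : ((N - ℓ).choose (M - ℓ) : ℝ) ≠ 0 := by
      exact_mod_cast (Nat.choose_pos (by omega : M - ℓ ≤ N - ℓ)).ne'
    rw [e1]; field_simp
  have e4 : (ex M H : ℝ) / M.choose ℓ
      + (H.copies G.edges).card * (M.choose v) / N.choose v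
      = (N.choose M * ex M H
      + (H.copies G.edges).card * (N - v).choose (M - v) * M.choose ℓ)
        / (N.choose M * M.choose ℓ) := by
    field_simp
    linear_combination ((H.copies G.edges).card : ℝ) * M.choose ℓ * e2
  rw [e3, e4]
  gcongr

theorem ex_div_choose_le {ℓ N M : ℕ} {V : Type*} [Finite V] {H : LGraph ℓ V}
    (hH : H.edges.Nonempty) (hℓ : ℓ ≤ M) (hv : Nat.card V ≤ M) (hN : M ≤ N) :
    (ex N H : ℝ) / N.choose ℓ ≤ (ex M H : ℝ) / M.choose ℓ := by
  classical
  have := Fintype.ofFinite V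
  rw [Nat.card_eq_fintype_card] at hv
  obtain ⟨G, hG, hcard⟩ := exists_card_edges_eq_ex hH N
  have h := card_edges_div_choose_le H G hℓ hv hN
  rw [contains_iff_copies_nonempty, not_nonempty_iff_eq_empty] at hG
  simpa [hG, hcard] using h

theorem tendsto_ex_div_choose {ℓ : ℕ} {V : Type*} [Finite V] {H : LGraph ℓ V}
    (hH : H.edges.Nonempty) :
    Filter.Tendsto (fun N : ℕ => (ex N H : ℝ) / (N.choose ℓ : ℝ)) Filter.atTop
      (nhds H.turanDensity) := by
  refine tendsto_nhds_limUnder ?_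
  -- Monotonicity is available only from this size on, hence the shifted sequence.
  set m := max ℓ (Nat.card V)
  have hanti : Antitone fun k : ℕ => (ex (k + m) H : ℝ) / ((k + m).choose ℓ : ℝ) := by
    intro a b hab
    exact ex_div_choose_le hH (le_add_left (le_max_left _ _)) (le_add_left (le_max_right _ _))
      (by omega)
  have hb : BddBelow (Set.range fun k : ℕ => (ex (k + m) H : ℝ) / ((k + m).choose ℓ : ℝ)) :=
    ⟨0, by rintro _ ⟨k, rfl⟩; positivity⟩
  exact ⟨_, (Filter.tendsto_add_atTop_iff_nat m).1 (tendsto_atTop_ciInf hanti hb)⟩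

theorem exists_pos_mul_pow_le_choose (k : ℕ) :
    ∃ a : ℝ, 0 < a ∧ ∀ᶠ N : ℕ in Filter.atTop, a * (N : ℝ) ^ k ≤ N.choose k := by
  obtain ⟨c, hc, h⟩ := (isTheta_choose k).isBigO_symm.exists_pos
  refine ⟨c⁻¹, inv_pos.2 hc, h.bound.mono fun N hN => ?_⟩
  rw [inv_mul_le_iff₀ hc]
  simpa using hN

/-- Supersaturation: a density above the Turán density forces a positive proportion of all maps
of vertices to be copies. -/
theorem exists_mul_pow_le_card_copies {ℓ : ℕ} {V : Type*} [Fintype V] [DecidableEq V]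
    {H : LGraph ℓ V} (hH : H.edges.Nonempty) {γ : ℝ} (hγ : 0 < γ) :
    ∃ β : ℝ, 0 < β ∧ ∀ᶠ N : ℕ in Filter.atTop, ∀ G : LGraph ℓ (Fin N),
      (H.turanDensity + γ) * N.choose ℓ < G.edges.card →
        β * (N : ℝ) ^ Fintype.card V ≤ (H.copies G.edges).card := by
  set v := Fintype.card V with hv
  obtain ⟨a, ha, haN⟩ := exists_pos_mul_pow_le_choose v
  -- At this fixed M, half of the excess γ is spent on `ex M H`; the other half must come from
  -- M-sets containing copies.
  obtain ⟨M, hM, hMℓ, hMv⟩ := (((tendsto_ex_div_choose hH).eventually_lt_const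
    (lt_add_of_pos_right _ (half_pos hγ))).and ((Filter.eventually_ge_atTop ℓ).and
      (Filter.eventually_ge_atTop v))).exists
  have pM : (0 : ℝ) < M.choose v := by exact_mod_cast Nat.choose_pos hMv
  refine ⟨γ / 2 * a / M.choose v, by positivity, ?_⟩
  filter_upwards [haN, Filter.eventually_ge_atTop M] with N hN hMN G hG
  have p1 : (0 : ℝ) < N.choose ℓ := by exact_mod_cast Nat.choose_pos (hMℓ.trans hMN)
  have p2 : (0 : ℝ) < N.choose v := by exact_mod_cast Nat.choose_pos (hMv.trans hMN)
  have h := card_edges_div_choose_le H G hMℓ hMv hMN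
  rw [← lt_div_iff₀ p1] at hG
  have h2 : γ / 2 ≤ (H.copies G.edges).card * (M.choose v) / N.choose v := by linarith
  rw [le_div_iff₀ p2] at h2
  rw [div_mul_eq_mul_div, div_le_iff₀ pM, mul_assoc]
  exact (mul_le_mul_of_nonneg_left hN (half_pos hγ).le).trans h2

/-! ### Weighted copies and correlation with test functions -/

/-- The indicator function, on ordered tuples, of a family of sets. -/
def tupleIndicator {ℓ : ℕ} {α : Type*} [DecidableEq α] (E : Finset (Finset α))
    (x : Fin ℓ → α) : ℝ :=
  if univ.image x ∈ E then 1 else 0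

theorem tupleIndicator_nonneg {ℓ : ℕ} {α : Type*} [DecidableEq α] (E : Finset (Finset α))
    (x : Fin ℓ → α) : 0 ≤ tupleIndicator E x := by
  unfold tupleIndicator; split_ifs <;> norm_num

theorem tupleIndicator_le_one {ℓ : ℕ} {α : Type*} [DecidableEq α] (E : Finset (Finset α))
    (x : Fin ℓ → α) : tupleIndicator E x ≤ 1 := by
  unfold tupleIndicator; split_ifs <;> norm_num

/-- Exchanging `x` with the values of `y` on the range of `s` is an involution on pairs, so every
map φ arises equally often. -/
theorem sum_sum_extend {ι V α : Type*} [Fintype ι] [Fintype V] [Fintype α] [DecidableEq ι]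
    [DecidableEq V] (s : ι ↪ V) (F : (V → α) → ℝ) :
    ∑ y : V → α, ∑ x : ι → α, F (Function.extend s x y)
      = (Fintype.card α : ℝ) ^ Fintype.card ι * ∑ φ, F φ := by
  have hinv : Function.Involutive fun p : (V → α) × (ι → α) =>
      (Function.extend s p.2 p.1, p.1 ∘ s) := by
    rintro ⟨y, x⟩
    refine Prod.ext ?_ ?_
    · funext u
      by_cases hu : ∃ a, s a = u
      · obtain ⟨a, rfl⟩ := hu
        simp [s.injective.extend_apply]
      · simp [Function.extend_apply' _ _ _ hu]
    · funext a
      simp [s.injective.extend_apply]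
  rw [← Fintype.sum_prod_type' fun y x => F (Function.extend s x y)]
  refine (Equiv.sum_comp hinv.toPerm fun p => F p.1).trans ?_
  rw [Fintype.sum_prod_type, mul_sum]
  simp

/-- The test function on `ℓ`-tuples obtained by fixing the vertices outside the `i`-th edge
according to `y`, with weights `g` on the edges before `i` and `f` on those after `i`. -/
def testFun {ℓ r : ℕ} {V α : Type*} (s : Fin r → Fin ℓ ↪ V) (w : (V → α) → ℝ)
    (g f : (Fin ℓ → α) → ℝ) (i : Fin r) (φ : V → α) : ℝ :=
  w φ * ((∏ j with j < i, g (φ ∘ s j)) * ∏ j with i < j, f (φ ∘ s j))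

theorem testFun_nonneg {ℓ r : ℕ} {V α : Type*} {s : Fin r → Fin ℓ ↪ V} {w : (V → α) → ℝ}
    {g f : (Fin ℓ → α) → ℝ} (hw : ∀ φ, 0 ≤ w φ) (hg : ∀ x, 0 ≤ g x) (hf : ∀ x, 0 ≤ f x)
    (i : Fin r) (φ : V → α) : 0 ≤ testFun s w g f i φ :=
  mul_nonneg (hw _) (mul_nonneg (prod_nonneg fun _ _ => hg _) (prod_nonneg fun _ _ => hf _))

theorem testFun_le_one {ℓ r : ℕ} {V α : Type*} {s : Fin r → Fin ℓ ↪ V} {w : (V → α) → ℝ}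
    {g f : (Fin ℓ → α) → ℝ} (hw : ∀ φ, w φ ≤ 1) (hg : ∀ x, 0 ≤ g x)
    (hf : ∀ x, 0 ≤ f x) (hg' : ∀ x, g x ≤ 1) (hf' : ∀ x, f x ≤ 1)
    (i : Fin r) (φ : V → α) : testFun s w g f i φ ≤ 1 := by
  have h1 : ∏ j with j < i, g (φ ∘ s j) ≤ 1 := prod_le_one (fun _ _ => hg _) fun _ _ => hg' _
  have h2 : ∏ j with i < j, f (φ ∘ s j) ≤ 1 := prod_le_one (fun _ _ => hf _) fun _ _ => hf' _
  have h3 : 0 ≤ ∏ j with j < i, g (φ ∘ s j) := prod_nonneg fun _ _ => hg _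
  have h4 : 0 ≤ ∏ j with i < j, f (φ ∘ s j) := prod_nonneg fun _ _ => hf _
  exact mul_le_one₀ (hw _) (mul_nonneg h3 h4) (mul_le_one₀ h1 h4 h2)

/-- If the weighted number of copies is large for `g` and zero for `f`, then `g - f` correlates
with one of the test functions. -/
theorem exists_le_sum_mul_testFun {ℓ r : ℕ} {V α : Type*} [Fintype V] [DecidableEq V] [Fintype α]
    [Nonempty α] (s : Fin r → Fin ℓ ↪ V) (w : (V → α) → ℝ) (g f : (Fin ℓ → α) → ℝ)
    (hr : 0 < r) {ε : ℝ} (hf : ∑ φ : V → α, w φ * ∏ i, f (φ ∘ s i) = 0)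
    (hg : ε * (Fintype.card α : ℝ) ^ Fintype.card V < ∑ φ : V → α, w φ * ∏ i, g (φ ∘ s i)) :
    ∃ (i : Fin r) (y : V → α), ε / r * (Fintype.card α : ℝ) ^ ℓ ≤
      ∑ x, (g x - f x) * testFun s w g f i (Function.extend (s i) x y) := by
  by_contra! hcon
  set n : ℝ := (Fintype.card α : ℝ) with hn
  have hn0 : 0 < n := by rw [hn]; exact_mod_cast Fintype.card_pos
  have hr0 : (0 : ℝ) < r := by exact_mod_cast hr
  have h1 : ∀ φ : V → α, w φ * ∏ i, g (φ ∘ s i) - w φ * ∏ i, f (φ ∘ s i)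
      = ∑ i, (g (φ ∘ s i) - f (φ ∘ s i)) * testFun s w g f i φ := by
    intro φ
    -- Telescoping: f is replaced by g one edge at a time, so the change at edge i carries g on
    -- earlier edges and f on later ones.
    have := prod_add_ordered univ (fun i => f (φ ∘ s i)) fun i => g (φ ∘ s i) - f (φ ∘ s i)
    simp only [add_sub_cancel] at this
    rw [this, mul_add, add_sub_cancel_left, mul_sum]
    refine sum_congr rfl fun i _ => ?_
    rw [testFun]; ring
  have h2 : ∑ φ : V → α, w φ * ∏ i, g (φ ∘ s i)
      = ∑ i, ∑ φ : V → α, (g (φ ∘ s i) - f (φ ∘ s i)) * testFun s w g f i φ := by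
    rw [← sub_zero (∑ φ : V → α, w φ * ∏ i, g (φ ∘ s i)), ← hf, ← sum_sub_distrib, sum_comm]
    exact sum_congr rfl fun φ _ => h1 φ
  have h3 : ∀ i : Fin r, n ^ ℓ * ∑ φ : V → α, (g (φ ∘ s i) - f (φ ∘ s i)) * testFun s w g f i φ
      ≤ n ^ ℓ * (n ^ Fintype.card V * (ε / r)) := by
    intro i
    have h4 := sum_sum_extend (s i)
      fun φ : V → α => (g (φ ∘ s i) - f (φ ∘ s i)) * testFun s w g f i φ
    rw [Fintype.card_fin] at h4
    rw [← h4]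
    have h5 : ∀ y ∈ (univ : Finset (V → α)), ∑ x : Fin ℓ → α,
        (g (Function.extend (s i) x y ∘ s i) - f (Function.extend (s i) x y ∘ s i)) *
          testFun s w g f i (Function.extend (s i) x y) ≤ ε / r * n ^ ℓ := by
      intro y _
      have h6 : ∀ x : Fin ℓ → α, Function.extend (s i) x y ∘ s i = x := fun x => by
        funext a; simp [(s i).injective.extend_apply]
      simp only [h6]
      exact (hcon i y).le
    refine (sum_le_card_nsmul _ _ _ h5).trans (le_of_eq ?_)
    simp [← hn]
    ring
  have h4 : ∑ φ : V → α, w φ * ∏ i, g (φ ∘ s i) ≤ ε * n ^ Fintype.card V := by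
    rw [h2]
    refine (sum_le_card_nsmul _ _ _ fun i _ => le_of_mul_le_mul_left (h3 i) (by positivity)).trans
      (le_of_eq ?_)
    simp
    field_simp
  linarith

/-! ### Energy decrement -/

/-- Expanding the square, the correlation contributes -2c² per point and p ≤ 1 costs at most c².
Truncating at 0 only moves closer to f ≥ 0. -/
theorem sum_sq_sub_max_le {X : Type*} [Fintype X] {f g p : X → ℝ} {c : ℝ} (hc : 0 ≤ c)
    (hf : ∀ x, 0 ≤ f x) (hp : ∀ x, 0 ≤ p x) (hp' : ∀ x, p x ≤ 1)
    (h : c * Fintype.card X ≤ ∑ x, (g x - f x) * p x) :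
    ∑ x, (f x - max 0 (g x - c * p x)) ^ 2 ≤
      ∑ x, (f x - g x) ^ 2 - c ^ 2 * Fintype.card X := by
  have h1 : ∀ x, (f x - max 0 (g x - c * p x)) ^ 2 ≤
      (f x - g x) ^ 2 - 2 * c * ((g x - f x) * p x) + c ^ 2 := by
    intro x
    have h2 : (f x - (g x - c * p x)) ^ 2 ≤
        (f x - g x) ^ 2 - 2 * c * ((g x - f x) * p x) + c ^ 2 := by
      have : p x ^ 2 ≤ 1 := pow_le_one₀ (hp x) (hp' x)
      nlinarith [mul_le_mul_of_nonneg_left this (sq_nonneg c)]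
    refine le_trans ?_ h2
    rcases le_total 0 (g x - c * p x) with h0 | h0
    · rw [max_eq_right h0]
    · rw [max_eq_left h0]
      nlinarith [hf x]
  refine (sum_le_sum fun x _ => h1 x).trans ?_
  rw [sum_add_distrib, sum_sub_distrib, ← mul_sum, sum_const, card_univ, nsmul_eq_mul]
  nlinarith [mul_le_mul_of_nonneg_left h hc]

/-- Where g ≤ δ, raising gains 2δf and costs at most 3δ²; the assumed mass of f makes the total gain
at least 4δ² per point. -/
theorem sum_sq_sub_raise_le {X : Type*} [Fintype X] {f g : X → ℝ} {δ : ℝ} (hδ : 0 ≤ δ)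
    (h : 2 * δ * Fintype.card X ≤ ∑ x with g x ≤ δ, f x) :
    ∑ x, (f x - (if g x ≤ δ then g x + δ else g x)) ^ 2 ≤
      ∑ x, (f x - g x) ^ 2 - δ ^ 2 * Fintype.card X := by
  have h1 : ∀ x, (f x - (if g x ≤ δ then g x + δ else g x)) ^ 2 ≤
      (f x - g x) ^ 2 - 2 * δ * (if g x ≤ δ then f x else 0) + 3 * δ ^ 2 := by
    intro x
    split_ifs with hx
    · nlinarith [mul_le_mul_of_nonneg_left hx hδ]
    · nlinarith [sq_nonneg δ]
  refine (sum_le_sum fun x _ => h1 x).trans ?_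
  rw [sum_add_distrib, sum_sub_distrib, ← mul_sum, sum_const, card_univ, nsmul_eq_mul,
    ← sum_filter]
  nlinarith [mul_le_mul_of_nonneg_left h hδ]

/-! ### The small approximating family -/

/-- The `ℓ`-sets that meet the range of `y`. -/
def meeting {V α : Type*} [Fintype V] [Fintype α] [DecidableEq α] (ℓ : ℕ) (y : V → α) :
    Finset (Finset α) :=
  {S ∈ powersetCard ℓ univ | ∃ u, y u ∈ S}

theorem card_meeting_le {V α : Type*} [Fintype V] [Fintype α] [DecidableEq α] {ℓ : ℕ}
    (hℓ : 1 ≤ ℓ) (y : V → α) :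
    (meeting ℓ y).card ≤ Fintype.card V * Fintype.card α ^ (ℓ - 1) := by
  have hsub : meeting ℓ y ⊆
      univ.biUnion fun u => {S ∈ powersetCard ℓ (univ : Finset α) | {y u} ⊆ S} := by
    intro S hS
    obtain ⟨h1, u, hu⟩ := mem_filter.1 hS
    exact mem_biUnion.2 ⟨u, mem_univ _, mem_filter.2 ⟨h1, singleton_subset_iff.2 hu⟩⟩
  refine (card_le_card hsub).trans ?_
  rw [← card_univ (α := V)]
  refine card_biUnion_le_card_mul _ _ _ fun u _ => ?_
  rw [card_filter_powersetCard_subset _ _ _ (subset_univ _) (by simpa using hℓ)]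
  refine (Nat.choose_le_pow _ _).trans ?_
  rw [card_singleton, card_univ]
  exact Nat.pow_le_pow_left (Nat.sub_le _ _) _

/-- Every edge j ≠ i has a vertex off edge i, and that vertex is sent to a value of `y`. This is
what makes the number of test functions small. -/
theorem testFun_inter_meeting {ℓ r : ℕ} {V α : Type*} [Fintype V] [Fintype α] [DecidableEq α]
    (s : Fin r → Fin ℓ ↪ V) (hs : ∀ i j, i ≠ j → ∃ a, s j a ∉ Set.range (s i))
    (w : (V → α) → ℝ) (g : (Fin ℓ → α) → ℝ) {E : Finset (Finset α)}
    (hE : E ⊆ powersetCard ℓ univ) (i : Fin r) (x : Fin ℓ → α) (y : V → α) :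
    testFun s w g (tupleIndicator (E ∩ meeting ℓ y)) i (Function.extend (s i) x y)
      = testFun s w g (tupleIndicator E) i (Function.extend (s i) x y) := by
  unfold testFun
  congr 2
  refine prod_congr rfl fun j hj => ?_
  obtain ⟨a, ha⟩ := hs i j (mem_filter.1 hj).2.ne
  unfold tupleIndicator
  refine if_congr ⟨fun h => (mem_inter.1 h).1, fun h => mem_inter.2 ⟨h, ?_⟩⟩ rfl rfl
  refine mem_filter.2 ⟨hE h, s j a, mem_image.2 ⟨a, mem_univ _, ?_⟩⟩
  exact Function.extend_apply' _ _ _ ha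

/-- A small family of functions approximating the indicator functions of all families of `ℓ`-sets
without (weighted) copies: either some member cannot be improved, or the energy has dropped. -/
theorem exists_finset_approx_or_energy_le {ℓ r : ℕ} {V α : Type*} [Fintype V] [DecidableEq V]
    [Fintype α] [DecidableEq α] [Nonempty α] (hℓ : 1 ≤ ℓ) (hr : 0 < r) (s : Fin r → Fin ℓ ↪ V)
    (hs : ∀ i j, i ≠ j → ∃ a, s j a ∉ Set.range (s i)) {w : (V → α) → ℝ}
    (hw : ∀ φ, 0 ≤ w φ) (hw' : ∀ φ, w φ ≤ 1) {ε δ : ℝ} (hε : 0 ≤ ε) (hδ : 0 ≤ δ)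
    (hδ' : δ ≤ 1 / 2) (k : ℕ) :
    ∃ F : Finset ((Fin ℓ → α) → ℝ),
      F.card ≤ (2 + r * (Fintype.card α ^ Fintype.card V *
        2 ^ (Fintype.card V * Fintype.card α ^ (ℓ - 1)))) ^ k ∧
      ∀ E ⊆ powersetCard ℓ (univ : Finset α),
        ∑ φ : V → α, w φ * ∏ i, tupleIndicator E (φ ∘ s i) = 0 →
        ∃ g ∈ F, (∀ x, 0 ≤ g x) ∧ (∀ x, g x ≤ 1) ∧
          ((∑ φ : V → α, w φ * ∏ i, g (φ ∘ s i) ≤ ε * (Fintype.card α : ℝ) ^ Fintype.card V ∧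
            ∑ x with g x ≤ δ, tupleIndicator E x ≤ 2 * δ * (Fintype.card α : ℝ) ^ ℓ) ∨
          ∑ x, (tupleIndicator E x - g x) ^ 2 ≤
            (1 - k * min ((ε / r) ^ 2) (δ ^ 2)) * (Fintype.card α : ℝ) ^ ℓ) := by
  classical
  have hX : (Fintype.card (Fin ℓ → α) : ℝ) = (Fintype.card α : ℝ) ^ ℓ := by simp
  have hc : 0 ≤ ε / r := by positivity
  induction k with
  | zero =>
    refine ⟨{1}, by simp, fun E _ _ => ⟨1, by simp, by simp, by simp, Or.inr ?_⟩⟩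
    rw [Nat.cast_zero, zero_mul, sub_zero, one_mul, ← hX, ← card_univ, ← nsmul_one]
    refine sum_le_card_nsmul _ _ _ fun x _ => ?_
    rw [Pi.one_apply, sq_le_one_iff_abs_le_one, abs_le]
    constructor <;> linarith [tupleIndicator_nonneg E x, tupleIndicator_le_one E x]
  | succ k ih =>
    obtain ⟨F, hF, hFE⟩ := ih
    set raise : ((Fin ℓ → α) → ℝ) → (Fin ℓ → α) → ℝ :=
      fun g x => if g x ≤ δ then g x + δ else g x with hraise
    -- Data of a lowering step: an edge of H, the fixed vertices, and the trace of E on the sets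
    -- meeting them.
    set T : Finset (Fin r × (Σ _ : V → α, Finset (Finset α))) :=
      univ ×ˢ univ.sigma fun y => (meeting ℓ y).powerset with hT
    set lower : Fin r × (Σ _ : V → α, Finset (Finset α)) → ((Fin ℓ → α) → ℝ) →
        (Fin ℓ → α) → ℝ := fun t g x => max 0 (g x - ε / r *
          testFun s w g (tupleIndicator t.2.2) t.1 (Function.extend (s t.1) x t.2.1)) with hlower
    have hTcard : T.card ≤ r * (Fintype.card α ^ Fintype.card V *
        2 ^ (Fintype.card V * Fintype.card α ^ (ℓ - 1))) := by
      rw [hT, card_product, card_univ, Fintype.card_fin, card_sigma]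
      gcongr
      refine (sum_le_card_nsmul _ _ (2 ^ (Fintype.card V * Fintype.card α ^ (ℓ - 1)))
        fun y _ => ?_).trans (by simp)
      rw [card_powerset]
      exact Nat.pow_le_pow_right two_pos (card_meeting_le hℓ y)
    refine ⟨(F ∪ F.image raise) ∪ image₂ lower T F, ?_, ?_⟩
    · calc _ ≤ (F ∪ F.image raise).card + (image₂ lower T F).card := card_union_le _ _
        _ ≤ (F.card + F.card) + T.card * F.card := by
          gcongr
          · exact (card_union_le _ _).trans (Nat.add_le_add_left card_image_le _)
          · exact card_image₂_le _ _ _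
        _ = F.card * (2 + T.card) := by ring
        _ ≤ _ := by
          rw [pow_succ]
          gcongr
    · intro E hE hE0
      obtain ⟨g, hgF, hg0, hg1, hg⟩ := hFE E hE hE0
      rcases hg with hg | hg
      · exact ⟨g, by simp [hgF], hg0, hg1, Or.inl hg⟩
      by_cases h1 : ∑ φ : V → α, w φ * ∏ i, g (φ ∘ s i)
          ≤ ε * (Fintype.card α : ℝ) ^ Fintype.card V
      · by_cases h2 : ∑ x with g x ≤ δ, tupleIndicator E x ≤ 2 * δ * (Fintype.card α : ℝ) ^ ℓ
        · exact ⟨g, by simp [hgF], hg0, hg1, Or.inl ⟨h1, h2⟩⟩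
        · have h3 := sum_sq_sub_raise_le (f := tupleIndicator E) (g := g) hδ
            (by rw [hX]; exact (not_le.1 h2).le)
          refine ⟨raise g, ?_, fun x => ?_, fun x => ?_, Or.inr (h3.trans ?_)⟩
          · exact mem_union_left _ (mem_union_right _ (mem_image_of_mem _ hgF))
          · simp only [hraise]
            split_ifs
            · exact add_nonneg (hg0 x) hδ
            · exact hg0 x
          · simp only [hraise]
            split_ifs
            · linarith
            · exact hg1 x
          · rw [hX]
            have := mul_le_mul_of_nonneg_right (min_le_right ((ε / r) ^ 2) (δ ^ 2))
              (by positivity : (0 : ℝ) ≤ (Fintype.card α : ℝ) ^ ℓ)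
            push_cast
            linarith
      · obtain ⟨i, y, hiy⟩ := exists_le_sum_mul_testFun s w g (tupleIndicator E) hr hE0
          (not_le.1 h1)
        have hp0 := testFun_nonneg (s := s) hw hg0 (tupleIndicator_nonneg E) i
        have hp1 := testFun_le_one (s := s) hw' hg0 (tupleIndicator_nonneg E) hg1
          (tupleIndicator_le_one E) i
        have h3 := sum_sq_sub_max_le hc (tupleIndicator_nonneg E)
          (fun x => hp0 (Function.extend (s i) x y)) (fun x => hp1 (Function.extend (s i) x y))
          (by rw [hX]; exact hiy)
        have hlow : lower (i, ⟨y, E ∩ meeting ℓ y⟩) g = fun x => max 0 (g x - ε / r *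
            testFun s w g (tupleIndicator E) i (Function.extend (s i) x y)) := by
          funext x
          simp only [hlower]
          rw [testFun_inter_meeting s hs w g hE]
        refine ⟨lower (i, ⟨y, E ∩ meeting ℓ y⟩) g, ?_, fun x => ?_, fun x => ?_,
          Or.inr ?_⟩
        · refine mem_union_right _ (mem_image₂_of_mem ?_ hgF)
          simp [hT]
        · exact le_max_left _ _
        · rw [hlow]
          refine max_le zero_le_one ?_
          linarith [hg1 x, mul_nonneg hc (hp0 (Function.extend (s i) x y))]
        · rw [hlow]
          refine h3.trans ?_
          rw [hX]
          have := mul_le_mul_of_nonneg_right (min_le_left ((ε / r) ^ 2) (δ ^ 2))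
            (by positivity : (0 : ℝ) ≤ (Fintype.card α : ℝ) ^ ℓ)
          push_cast
          linarith

/-! ### Containers and counting -/

/-- Chernoff argument: with weights x^|D| the subsets of X have total weight at most exp(L|X|/2),
and each small D weighs at least exp(-L|X|/2), where 2^η = exp L. -/
theorem exists_card_small_subsets_le {η : ℝ} (hη : 0 < η) :
    ∃ δ : ℝ, 0 < δ ∧ ∀ {β : Type} [DecidableEq β] (X : Finset β),
      (#{D ∈ X.powerset | (D.card : ℝ) ≤ δ * X.card} : ℝ) ≤ (2 : ℝ) ^ (η * X.card) := by
  set L : ℝ := η * Real.log 2 with hL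
  have hL0 : 0 < L := mul_pos hη (Real.log_pos one_lt_two)
  set x : ℝ := min (1 / 2) (L / 2) with hx
  have hx0 : 0 < x := lt_min (by norm_num) (half_pos hL0)
  have hx1 : x < 1 := (min_le_left _ _).trans_lt (by norm_num)
  have hlog : 0 < -Real.log x := neg_pos.2 (Real.log_neg hx0 hx1)
  refine ⟨L / 2 / -Real.log x, by positivity, fun X => ?_⟩
  set n : ℝ := (X.card : ℝ) with hn
  have h1 : ∑ D ∈ X.powerset, x ^ D.card = (1 + x) ^ X.card := by
    simpa [add_comm] using sum_pow_mul_eq_add_pow x 1 X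
  have h2 : (1 + x) ^ X.card ≤ Real.exp (L / 2 * n) := by
    calc (1 + x) ^ X.card ≤ Real.exp x ^ X.card := by
          gcongr
          linarith [Real.add_one_le_exp x]
      _ = Real.exp (n * x) := by rw [← Real.exp_nat_mul]
      _ ≤ _ := by
          rw [mul_comm]
          gcongr
          exact min_le_right _ _
  set S := {D ∈ X.powerset | (D.card : ℝ) ≤ L / 2 / -Real.log x * n} with hS
  have h3 : (S.card : ℝ) * Real.exp (-(L / 2 * n)) ≤ ∑ D ∈ X.powerset, x ^ D.card := by
    rw [← nsmul_eq_mul]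
    refine (card_nsmul_le_sum S (fun D => x ^ D.card) _ fun D hD => ?_).trans
      (sum_le_sum_of_subset_of_nonneg (filter_subset _ _) fun _ _ _ => by positivity)
    rw [← Real.exp_log (pow_pos hx0 D.card), Real.log_pow]
    gcongr
    have h4 : (D.card : ℝ) * -Real.log x ≤ L / 2 * n := by
      have := mul_le_mul_of_nonneg_right (mem_filter.1 hD).2 hlog.le
      rwa [mul_right_comm, div_mul_cancel₀ _ hlog.ne'] at this
    linarith
  have h5 : (2 : ℝ) ^ (η * n) = Real.exp (L / 2 * n) * Real.exp (L / 2 * n) := by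
    rw [← Real.exp_add, Real.rpow_def_of_pos two_pos, hL]
    ring_nf
  rw [h5]
  have h6 := (h3.trans h1.le).trans h2
  rwa [Real.exp_neg, ← div_eq_mul_inv, div_le_iff₀ (Real.exp_pos _)] at h6

/-- Distinct edges have equal size, so neither contains the other. -/
theorem exists_enum_edges {ℓ : ℕ} {V : Type*} [DecidableEq V] (H : LGraph ℓ V) :
    ∃ (r : ℕ) (s : Fin r → Fin ℓ ↪ V), (∀ e, e ∈ H.edges ↔ ∃ i, univ.map (s i) = e) ∧
      ∀ i j, i ≠ j → ∃ a, s j a ∉ Set.range (s i) := by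
  have h1 : ∀ e : H.edges, ∃ t : Fin ℓ ↪ V, univ.map t = (e : Finset V) := by
    intro e
    have hc : (e : Finset V).card = ℓ := H.sized e.2
    refine ⟨((e : Finset V).equivFinOfCardEq hc).symm.toEmbedding.trans
      (Function.Embedding.subtype _), ?_⟩
    rw [← map_map, map_univ_equiv]
    ext a
    simp
  choose t ht using h1
  refine ⟨H.edges.card, fun i => t (H.edges.equivFin.symm i), fun e => ⟨fun he => ?_, ?_⟩, ?_⟩
  · exact ⟨H.edges.equivFin ⟨e, he⟩, by simp [ht]⟩
  · rintro ⟨i, rfl⟩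
    rw [ht]
    exact (H.edges.equivFin.symm i).2
  · intro i j hij
    by_contra! hcon
    refine hij (H.edges.equivFin.symm.injective (Subtype.ext ?_))
    rw [← ht, ← ht]
    refine (eq_of_subset_of_card_le (fun a ha => ?_) (by simp)).symm
    obtain ⟨b, -, rfl⟩ := mem_map.1 ha
    obtain ⟨c, hc⟩ := hcon b
    exact mem_map.2 ⟨c, mem_univ _, hc⟩

theorem mem_copies_iff {ℓ r : ℕ} {V α : Type*} [Fintype V] [DecidableEq V] [Fintype α]
    [DecidableEq α] {H : LGraph ℓ V} {s : Fin r → Fin ℓ ↪ V}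
    (hs : ∀ e, e ∈ H.edges ↔ ∃ i, univ.map (s i) = e) {E : Finset (Finset α)} {φ : V → α} :
    φ ∈ H.copies E ↔ Function.Injective φ ∧ ∀ i, univ.image (φ ∘ s i) ∈ E := by
  have : ∀ i, univ.image (φ ∘ s i) = (univ.map (s i)).image φ := fun i => by
    rw [map_eq_image, image_image]
  simp only [copies, mem_filter, mem_univ, true_and, hs, this]
  simp

open scoped Classical in
theorem sum_tupleIndicator_eq_zero {ℓ r : ℕ} {V α : Type*} [Fintype V] [DecidableEq V] [Fintype α]
    [DecidableEq α] {H : LGraph ℓ V} {s : Fin r → Fin ℓ ↪ V}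
    (hs : ∀ e, e ∈ H.edges ↔ ∃ i, univ.map (s i) = e) {E : Finset (Finset α)}
    (hE : H.copies E = ∅) :
    ∑ φ : V → α, (if Function.Injective φ then (1 : ℝ) else 0) *
      ∏ i, tupleIndicator E (φ ∘ s i) = 0 := by
  refine sum_eq_zero fun φ _ => ?_
  split_ifs with hφ
  · rw [one_mul, prod_eq_zero_iff]
    by_contra! hcon
    have : φ ∈ H.copies E := (mem_copies_iff hs).2 ⟨hφ, fun i => by
      by_contra h
      exact hcon i (mem_univ _) (if_neg h)⟩
    simp [hE] at this
  · exact zero_mul _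

/-- The `ℓ`-sets on all of whose orderings `g` exceeds `δ`. -/
noncomputable def container {ℓ : ℕ} {α : Type*} [Fintype α] [DecidableEq α] (δ : ℝ)
    (g : (Fin ℓ → α) → ℝ) : Finset (Finset α) :=
  {S ∈ powersetCard ℓ univ | ∀ x, univ.image x = S → δ < g x}

theorem container_subset {ℓ : ℕ} {α : Type*} [Fintype α] [DecidableEq α] (δ : ℝ)
    (g : (Fin ℓ → α) → ℝ) : container δ g ⊆ powersetCard ℓ univ :=
  filter_subset _ _

-- Each copy of H in the container has g > δ on all r edges, so it contributes at least δ^r to the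
-- weighted count.
open scoped Classical in
theorem card_copies_container_mul_le {ℓ r : ℕ} {V α : Type*} [Fintype V] [DecidableEq V]
    [Fintype α] [DecidableEq α] {H : LGraph ℓ V} {s : Fin r → Fin ℓ ↪ V}
    (hs : ∀ e, e ∈ H.edges ↔ ∃ i, univ.map (s i) = e) {δ : ℝ} (hδ : 0 ≤ δ)
    {g : (Fin ℓ → α) → ℝ} (hg : ∀ x, 0 ≤ g x) :
    (H.copies (container δ g)).card * δ ^ r ≤
      ∑ φ : V → α, (if Function.Injective φ then (1 : ℝ) else 0) * ∏ i, g (φ ∘ s i) := by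
  rw [← nsmul_eq_mul]
  refine (card_nsmul_le_sum _ (fun φ : V → α =>
    (if Function.Injective φ then (1 : ℝ) else 0) * ∏ i, g (φ ∘ s i)) _ fun φ hφ => ?_).trans
      (sum_le_sum_of_subset_of_nonneg (subset_univ _) fun φ _ _ =>
        mul_nonneg (by split_ifs <;> norm_num) (prod_nonneg fun _ _ => hg _))
  obtain ⟨h1, h2⟩ := (mem_copies_iff hs).1 hφ
  rw [if_pos h1, one_mul]
  calc δ ^ r = ∏ _i : Fin r, δ := by simp
    _ ≤ _ := prod_le_prod (fun _ _ => hδ) fun i _ => ((mem_filter.1 (h2 i)).2 _ rfl).le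

theorem card_sdiff_container_le {ℓ : ℕ} {α : Type*} [Fintype α] [DecidableEq α] (δ : ℝ)
    (g : (Fin ℓ → α) → ℝ) {E : Finset (Finset α)} (hE : E ⊆ powersetCard ℓ univ) :
    ((E \ container δ g).card : ℝ) ≤ ∑ x with g x ≤ δ, tupleIndicator E x := by
  unfold tupleIndicator
  rw [sum_boole, Nat.cast_le]
  refine (card_le_card fun S hS => ?_).trans
    (card_image_le (f := fun x : Fin ℓ → α => univ.image x))
  obtain ⟨h1, h2⟩ := mem_sdiff.1 hS
  obtain ⟨x, hx, hgx⟩ : ∃ x, univ.image x = S ∧ g x ≤ δ := by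
    by_contra! hcon
    exact h2 (mem_filter.2 ⟨hE h1, hcon⟩)
  exact mem_image.2 ⟨x, mem_filter.2 ⟨mem_filter.2 ⟨mem_univ _, hgx⟩, by rwa [hx]⟩, hx⟩

/-- Counting a family of sets each of which is almost contained in a small container. -/
theorem card_le_of_almost_containers {β ι : Type*} [DecidableEq β] {X : Finset β}
    {𝒜 : Finset (Finset β)} {F : Finset ι} {C : ι → Finset β} {m d : ℝ}
    (h𝒜 : ∀ E ∈ 𝒜, E ⊆ X)
    (h : ∀ E ∈ 𝒜, ∃ i ∈ F, ((C i).card : ℝ) ≤ m ∧ ((E \ C i).card : ℝ) ≤ d) :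
    (𝒜.card : ℝ) ≤ F.card * ((2 : ℝ) ^ m * #{D ∈ X.powerset | (D.card : ℝ) ≤ d}) := by
  set S := {D ∈ X.powerset | (D.card : ℝ) ≤ d} with hS
  -- E is recovered from its parts inside and outside its container.
  have hsub : 𝒜 ⊆ {i ∈ F | ((C i).card : ℝ) ≤ m}.biUnion
      fun i => image₂ (· ∪ ·) (C i).powerset S := by
    intro E hE
    obtain ⟨i, hi, hm, hd⟩ := h E hE
    refine mem_biUnion.2 ⟨i, mem_filter.2 ⟨hi, hm⟩, mem_image₂.2 ⟨E ∩ C i, ?_, E \ C i, ?_, ?_⟩⟩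
    · exact mem_powerset.2 inter_subset_right
    · exact mem_filter.2 ⟨mem_powerset.2 (sdiff_subset.trans (h𝒜 E hE)), hd⟩
    · rw [union_comm]
      exact sdiff_union_inter E (C i)
  calc (𝒜.card : ℝ) ≤ ∑ i ∈ F with ((C i).card : ℝ) ≤ m,
        ((image₂ (· ∪ ·) (C i).powerset S).card : ℝ) := by
        exact_mod_cast (card_le_card hsub).trans card_biUnion_le
    _ ≤ ∑ i ∈ F with ((C i).card : ℝ) ≤ m, (2 : ℝ) ^ m * S.card := by
        refine sum_le_sum fun i hi => ?_
        have h1 : ((image₂ (· ∪ ·) (C i).powerset S).card : ℝ) ≤ 2 ^ (C i).card * S.card := by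
          have := card_image₂_le (· ∪ ·) (C i).powerset S
          rw [card_powerset] at this
          exact_mod_cast this
        refine h1.trans ?_
        gcongr
        rw [← Real.rpow_natCast]
        exact Real.rpow_le_rpow_of_exponent_le one_le_two (mem_filter.1 hi).2
    _ ≤ _ := by
        rw [sum_const, nsmul_eq_mul]
        gcongr
        exact filter_subset _ _

/-- For fixed K the logarithm of the left side is O(log N + N^{ℓ-1}), which is o(N^ℓ). -/
theorem eventually_pow_le_two_rpow {ℓ : ℕ} (hℓ : 1 ≤ ℓ) (r v K : ℕ) {c : ℝ} (hc : 0 < c) :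
    ∀ᶠ N : ℕ in Filter.atTop,
      (((2 + r * (N ^ v * 2 ^ (v * N ^ (ℓ - 1)))) ^ K : ℕ) : ℝ) ≤ (2 : ℝ) ^ (c * (N : ℝ) ^ ℓ) := by
  have hlog2 : 0 < Real.log 2 := Real.log_pos one_lt_two
  set A : ℝ := K * (v + 1) + 1 with hA
  set B : ℝ := K * v * Real.log 2 + 1 with hB
  have hA0 : 0 < A := by positivity
  have hB0 : 0 < B := by positivity
  set c' := c * Real.log 2 with hc'
  have hc0 : 0 < c' := by positivity
  have hlog : ∀ᶠ N : ℕ in Filter.atTop, Real.log N ≤ c' / (2 * A) * N := by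
    have := (Real.isLittleO_log_id_atTop.comp_tendsto tendsto_natCast_atTop_atTop).bound
      (show 0 < c' / (2 * A) by positivity)
    filter_upwards [this] with N hN
    refine (le_abs_self _).trans ?_
    simpa using hN
  have hlin : ∀ᶠ N : ℕ in Filter.atTop, 2 * B / c' ≤ (N : ℝ) :=
    tendsto_natCast_atTop_atTop.eventually_ge_atTop _
  filter_upwards [hlog, hlin, Filter.eventually_ge_atTop (2 + r), Filter.eventually_ge_atTop 1]
    with N h1 h2 h3 h4
  have hN0 : (0 : ℝ) < N := by exact_mod_cast h4
  have hN1 : (1 : ℝ) ≤ N := by exact_mod_cast h4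
  have hbase : (2 + r * (N ^ v * 2 ^ (v * N ^ (ℓ - 1)))) ^ K
      ≤ (N ^ (v + 1) * 2 ^ (v * N ^ (ℓ - 1))) ^ K := by
    gcongr
    have : 1 ≤ N ^ v * 2 ^ (v * N ^ (ℓ - 1)) := Nat.mul_pos (pow_pos h4 _) (by positivity)
    calc 2 + r * (N ^ v * 2 ^ (v * N ^ (ℓ - 1)))
        ≤ (2 + r) * (N ^ v * 2 ^ (v * N ^ (ℓ - 1))) := by nlinarith
      _ ≤ N * (N ^ v * 2 ^ (v * N ^ (ℓ - 1))) := by gcongr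
      _ = _ := by ring
  refine (Nat.cast_le.2 hbase).trans ?_
  rw [Real.rpow_def_of_pos two_pos]
  push_cast
  have hpos : (0 : ℝ) < ((N : ℝ) ^ (v + 1) * 2 ^ (v * N ^ (ℓ - 1))) ^ K := by positivity
  rw [← Real.exp_log hpos]
  gcongr
  rw [Real.log_pow, Real.log_mul (by positivity) (by positivity), Real.log_pow, Real.log_pow]
  push_cast
  obtain ⟨k, rfl⟩ : ∃ k, ℓ = k + 1 := ⟨ℓ - 1, by omega⟩
  rw [Nat.add_sub_cancel]
  have hp : (1 : ℝ) ≤ (N : ℝ) ^ k := one_le_pow₀ hN1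
  have e1 : A * Real.log N ≤ c' / 2 * (N : ℝ) ^ (k + 1) := by
    calc A * Real.log N ≤ A * (c' / (2 * A) * N) := by gcongr
      _ = c' / 2 * N := by field_simp
      _ ≤ c' / 2 * (N : ℝ) ^ (k + 1) := by
        gcongr
        exact le_self_pow₀ hN1 (by omega)
  have e2 : B * (N : ℝ) ^ k ≤ c' / 2 * (N : ℝ) ^ (k + 1) := by
    rw [div_le_iff₀ hc0] at h2
    calc B * (N : ℝ) ^ k ≤ (N * c' / 2) * (N : ℝ) ^ k := by
          gcongr
          linarith
      _ = _ := by ring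
  have e3 : 0 ≤ Real.log N := Real.log_nonneg hN1
  calc (K : ℝ) * ((v + 1) * Real.log N + v * (N : ℝ) ^ k * Real.log 2)
      = (A - 1) * Real.log N + (B - 1) * (N : ℝ) ^ k := by rw [hA, hB]; ring
    _ ≤ A * Real.log N + B * (N : ℝ) ^ k := by linarith
    _ ≤ c' * (N : ℝ) ^ (k + 1) := by linarith
    _ = _ := by rw [hc']; ring

theorem eventually_ncard_freeGraphs_le {ℓ : ℕ} {V : Type*} [Finite V] {H : LGraph ℓ V}
    (hH : H.edges.Nonempty) (hℓ : 1 ≤ ℓ) {η : ℝ} (hη : 0 < η) :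
    ∀ᶠ N : ℕ in Filter.atTop, ((H.freeGraphs N).ncard : ℝ) ≤
      (2 : ℝ) ^ ((H.turanDensity + η) * (N.choose ℓ : ℝ)) := by
  classical
  have := Fintype.ofFinite V
  obtain ⟨r, s, hs, hs'⟩ := H.exists_enum_edges
  have hr0 : 0 < r := by
    obtain ⟨e, he⟩ := hH
    obtain ⟨i, -⟩ := (hs e).1 he
    exact i.pos
  have hrR : (0 : ℝ) < r := by exact_mod_cast hr0
  have hη3 : 0 < η / 3 := by positivity
  obtain ⟨δ₁, hδ₁, hsmall⟩ := exists_card_small_subsets_le hη3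
  obtain ⟨a, ha, haN⟩ := exists_pos_mul_pow_le_choose ℓ
  obtain ⟨β, hβ, hsat⟩ := exists_mul_pow_le_card_copies hH hη3
  -- The bound 1/2 keeps raised functions at most 1; the other makes the leftover 2δN^ℓ at most δ₁
  -- binom(N,ℓ).
  set δ := min (1 / 2) (δ₁ * a / 2) with hδ
  have hδ0 : 0 < δ := lt_min (by norm_num) (by positivity)
  -- A container then has at most half the copies that supersaturation would force.
  set ε := δ ^ r * (β / 2) with hε
  have hε0 : 0 < ε := by positivity
  set κ := min ((ε / r) ^ 2) (δ ^ 2) with hκ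
  have hκ0 : 0 < κ := lt_min (by positivity) (by positivity)
  -- After K steps the energy bound would be negative, so the other alternative holds.
  obtain ⟨K, hK⟩ := exists_nat_gt (1 / κ)
  rw [div_lt_iff₀ hκ0] at hK
  filter_upwards [haN, hsat, eventually_pow_le_two_rpow hℓ r (Fintype.card V) K
    (show 0 < η / 3 * a by positivity), Filter.eventually_ge_atTop 1] with N hN hsatN hFN hN1
  have hN0 : (0 : ℝ) < N := by exact_mod_cast hN1
  have : NeZero N := ⟨by omega⟩
  obtain ⟨F, hF, hFE⟩ := exists_finset_approx_or_energy_le (α := Fin N) hℓ hr0 s hs'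
    (w := fun φ => if Function.Injective φ then 1 else 0)
    (fun φ => by split_ifs <;> norm_num) (fun φ => by split_ifs <;> norm_num) hε0.le hδ0.le
    (min_le_left _ _) K
  simp only [Fintype.card_fin] at hF hFE
  set X : Finset (Finset (Fin N)) := powersetCard ℓ univ with hX
  have hXcard : X.card = N.choose ℓ := by simp [hX]
  set 𝒜 : Finset (Finset (Finset (Fin N))) := {E ∈ X.powerset | H.copies E = ∅} with h𝒜
  have hcount : ((H.freeGraphs N).ncard : ℝ) ≤ 𝒜.card := by
    rw [← Set.ncard_image_of_injective (H.freeGraphs N) edges_injective, ← Set.ncard_coe_finset,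
      Nat.cast_le]
    refine Set.ncard_le_ncard ?_ (Set.toFinite _)
    rintro _ ⟨G, hG, rfl⟩
    have hG' : ¬ G.Contains H := hG
    rw [contains_iff_copies_nonempty, not_nonempty_iff_eq_empty] at hG'
    exact mem_coe.2 (mem_filter.2 ⟨mem_powerset.2 G.edges_subset_powersetCard, hG'⟩)
  have hcont : ∀ E ∈ 𝒜, ∃ g ∈ F,
      ((container δ g).card : ℝ) ≤ (H.turanDensity + η / 3) * N.choose ℓ ∧
      ((E \ container δ g).card : ℝ) ≤ δ₁ * X.card := by
    intro E hE
    obtain ⟨hEX, hE0⟩ := mem_filter.1 hE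
    rw [mem_powerset] at hEX
    obtain ⟨g, hgF, hg0, -, hg⟩ := hFE E hEX (sum_tupleIndicator_eq_zero hs hE0)
    have hpos : (0 : ℝ) < (N : ℝ) ^ ℓ := by positivity
    rcases hg with ⟨hg1, hg2⟩ | hg
    · refine ⟨g, hgF, ?_, ?_⟩
      · by_contra! hcon
        have h1 := hsatN ⟨container δ g, fun S hS =>
          mem_powersetCard_univ.1 (container_subset δ g (mem_coe.1 hS))⟩ hcon
        have h2 := (card_copies_container_mul_le hs hδ0.le hg0).trans hg1
        have h3 : ((H.copies (container δ g)).card : ℝ)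
            ≤ β / 2 * (N : ℝ) ^ Fintype.card V := by
          refine le_of_mul_le_mul_right (h2.trans (le_of_eq ?_)) (pow_pos hδ0 r)
          rw [hε]; ring
        have h4 : 0 < β * (N : ℝ) ^ Fintype.card V := by positivity
        have h5 := h1.trans h3
        linarith
      · refine (card_sdiff_container_le δ g hEX).trans (hg2.trans ?_)
        rw [hXcard]
        calc 2 * δ * (N : ℝ) ^ ℓ ≤ 2 * (δ₁ * a / 2) * (N : ℝ) ^ ℓ := by
              gcongr
              exact min_le_right _ _
          _ = δ₁ * (a * (N : ℝ) ^ ℓ) := by ring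
          _ ≤ _ := by gcongr
    · exfalso
      have h1 : (1 - K * κ) * (N : ℝ) ^ ℓ < 0 := mul_neg_of_neg_of_pos (by linarith) hpos
      have h2 : 0 ≤ ∑ x, (tupleIndicator E x - g x) ^ 2 := sum_nonneg fun _ _ => sq_nonneg _
      linarith
  have hmain := card_le_of_almost_containers
    (fun E hE => mem_powerset.1 (mem_filter.1 hE).1) hcont
  have hFc : (F.card : ℝ) ≤ (2 : ℝ) ^ (η / 3 * N.choose ℓ) := by
    refine (Nat.cast_le.2 hF).trans (hFN.trans ?_)
    refine Real.rpow_le_rpow_of_exponent_le one_le_two ?_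
    rw [mul_assoc]
    gcongr
  refine hcount.trans (hmain.trans ?_)
  have hsm := hsmall X
  rw [hXcard] at hsm ⊢
  -- The three shares η/3 pay for the number of containers, their excess size and the leftover sets.
  calc _ ≤ (2 : ℝ) ^ (η / 3 * N.choose ℓ) * ((2 : ℝ) ^ ((H.turanDensity + η / 3) * N.choose ℓ) *
        (2 : ℝ) ^ (η / 3 * N.choose ℓ)) := by gcongr
    _ = _ := by
      rw [← Real.rpow_add two_pos, ← Real.rpow_add two_pos]
      congr 1
      ring

/-! ### The case ℓ = 0 and the conclusion -/

theorem eventually_zero_freeGraphs {V : Type*} [Finite V] {H : LGraph 0 V}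
    (hH : H.edges.Nonempty) :
    ∀ᶠ N : ℕ in Filter.atTop, H.freeGraphs N = {⟨∅, by simp [Set.Sized]⟩} := by
  have := Fintype.ofFinite V
  filter_upwards [Filter.eventually_ge_atTop (Fintype.card V)] with N hN
  refine Set.eq_singleton_iff_unique_mem.2 ⟨not_contains_of_edges_eq_empty hH rfl, ?_⟩
  intro G hG
  by_contra hne
  refine hG ?_
  obtain ⟨f⟩ : Nonempty (V ↪ Fin N) :=
    Function.Embedding.nonempty_of_card_le (by simpa using hN)
  obtain ⟨e, he⟩ : G.edges.Nonempty := by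
    rw [nonempty_iff_ne_empty]
    exact fun h => hne (LGraph.ext h)
  have he0 : e = ∅ := card_eq_zero.1 (G.sized he)
  refine ⟨f, fun e' he' => ?_⟩
  have he0' : e' = ∅ := card_eq_zero.1 (H.sized he')
  rw [he0', map_empty, ← he0]
  exact he

theorem tendsto_logb_ncard_freeGraphs {ℓ : ℕ} {V : Type*} [Finite V] {H : LGraph ℓ V}
    (hH : H.edges.Nonempty) :
    Filter.Tendsto (fun N : ℕ => Real.logb 2 (H.freeGraphs N).ncard / (N.choose ℓ : ℝ))
      Filter.atTop (nhds H.turanDensity) := by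
  rcases Nat.eq_zero_or_pos ℓ with rfl | hℓ
  · refine (tendsto_ex_div_choose hH).congr' ?_
    filter_upwards [eventually_zero_freeGraphs hH] with N hN
    simp [ex, hN]
  have hcount : ∀ N, (0 : ℝ) < (H.freeGraphs N).ncard := fun N => by
    have := two_pow_ex_le_ncard_freeGraphs hH N
    exact_mod_cast (pow_pos two_pos _).trans_le this
  refine tendsto_order.2 ⟨fun b hb => ?_, fun b hb => ?_⟩
  · filter_upwards [(tendsto_ex_div_choose hH).eventually_const_lt hb] with N hN
    refine hN.trans_le ?_
    gcongr
    rw [Real.le_logb_iff_rpow_le one_lt_two (hcount N), Real.rpow_natCast]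
    exact_mod_cast two_pow_ex_le_ncard_freeGraphs hH N
  · filter_upwards [eventually_ncard_freeGraphs_le hH hℓ (half_pos (sub_pos.2 hb)),
      Filter.eventually_ge_atTop ℓ] with N hN hNℓ
    have hp : (0 : ℝ) < N.choose ℓ := by exact_mod_cast Nat.choose_pos hNℓ
    rw [← Real.logb_le_iff_le_rpow one_lt_two (hcount N), ← div_le_iff₀ hp] at hN
    linarith

end LGraph

theorem corollary1p4 {ℓ : ℕ} {V : Type*} [Finite V] (H : LGraph ℓ V) (hH : H.edges.Nonempty) :
    Filter.Tendsto (fun N : ℕ => (LGraph.ex N H : ℝ) / (N.choose ℓ : ℝ)) Filter.atTop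
        (nhds H.turanDensity) ∧
      ∃ δ : ℕ → ℝ, Filter.Tendsto δ Filter.atTop (nhds 0) ∧
        ∀ N : ℕ, ((H.freeGraphs N).ncard : ℝ) =
          (2 : ℝ) ^ ((H.turanDensity + δ N) * (N.choose ℓ : ℝ)) := by
  refine ⟨LGraph.tendsto_ex_div_choose hH,
    fun N => Real.logb 2 (H.freeGraphs N).ncard / (N.choose ℓ : ℝ) - H.turanDensity, ?_, ?_⟩
  · simpa using (LGraph.tendsto_logb_ncard_freeGraphs hH).sub_const H.turanDensity
  intro N
  have hpos : 0 < (H.freeGraphs N).ncard :=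
    (pow_pos two_pos _).trans_le (LGraph.two_pow_ex_le_ncard_freeGraphs hH N)
  rw [add_sub_cancel]
  -- If binom(N,ℓ) = 0, the right side is 1 whatever δ(N) is, and the empty graph is the only one.
  rcases Nat.eq_zero_or_pos (N.choose ℓ) with h0 | h0
  · have hsub : (H.freeGraphs N).ncard ≤ 1 := by
      refine (Set.ncard_le_one_iff (Set.toFinite _)).2 fun {G G'} _ _ => LGraph.ext ?_
      have h1 := G.card_edges_le_choose
      have h2 := G'.card_edges_le_choose
      rw [h0, Nat.le_zero, Finset.card_eq_zero] at h1 h2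
      rw [h1, h2]
    rw [h0, Nat.cast_zero, mul_zero, Real.rpow_zero]
    exact_mod_cast le_antisymm hsub hpos
  · rw [div_mul_cancel₀ _ (by exact_mod_cast h0.ne'),
      Real.rpow_logb two_pos (by norm_num) (by exact_mod_cast hpos)]
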